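/- There is a function $c:\mathbb{R}\to\mathbb{R}$, bounded away from $0$ when $\delta$ is (for every $\delta_0>0$ there is $\kappa>0$ with $c(\delta)\ge\kappa$ for all $\delta\in[\delta_0,1/2)$), such that the following holds. Let $0<\delta<1/2$, let $\mathcal{C}\subseteq\mathbb{F}_2^n$ be a binary linear code, let $0\le\epsilon\le 1$, and let $i\ne j$ be coordinates in $[n]$. Let $X$ be uniformly distributed on $\mathcal{C}$ and let $Y^\epsilon\in\{0,1,?\}^n$ be the result of passing $X$ through the binary erasure channel BEC($\epsilon$). Write $Y^\epsilon_{\sim i}$ for $Y^\epsilon$ without coordinate $i$, and $Y^\epsilon_{\sim i,j}$ for $Y^\epsilon$ without coordinates $i$ and $j$; information is measured in bits. For $z\in\{0,1\}^n$ and $(a,b)\in\{0,1\}^2$ say that $z$ covers the type $(a,b)$ if there is $x\in\mathcal{C}$ with $(x_i,x_j)=(a,b)$ and $\mathrm{supp}(x)\subseteq\mathrm{supp}(z)$. Let $\mathcal{B}_2,\mathcal{B}_3,\mathcal{B}_4$ be the sets of those $z$ that cover exactly one of the three nonzero types $(0,1),(1,0),(1,1)$, this one being $(0,1)$, $(1,0)$,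 $(1,1)$, respectively. Let $Z^\epsilon\in\{0,1\}^n$ be random with $Z^\epsilon_i=Z^\epsilon_j=1$ and with the other coordinates i.i.d. Bernoulli($\epsilon$). If $I(X_i;Y^\epsilon_{\sim i})\in(\delta,1-\delta)$, then $\Pr(Z^\epsilon\in\mathcal{B}_2\cup\mathcal{B}_3\cup\mathcal{B}_4)>0$, and $$I(X_i;X_j\mid Y^\epsilon_{\sim i,j})\ \ge\ \frac{c(\delta)}{\sqrt n}\,\alpha_{ij}^\epsilon,\qquad \alpha_{ij}^\epsilon:=\Pr\left(Z^\epsilon\in\mathcal{B}_4\mid Z^\epsilon\in\mathcal{B}_2\cup\mathcal{B}_3\cup\mathcal{B}_4\right).$$ -/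

import Mathlib

/-! ### Finite probability and Shannon information (in bits)

A probability law on a finite type `Ω` is given by its mass function `p : Ω → ℝ`. -/

section Information

variable {Ω α β γ : Type*} [Fintype Ω] [Fintype α] [Fintype β] [Fintype γ]

open Classical in
/-- The probability of the event `E` under the law `p`. -/
noncomputable def prob (p : Ω → ℝ) (E : Set Ω) : ℝ :=
  ∑ ω, if ω ∈ E then p ω else 0

/-- The conditional probability of `E` given `F`. -/
noncomputable def condProb (p : Ω → ℝ) (E F : Set Ω) : ℝ :=
  prob p (E ∩ F) / prob p F

/-- The Shannon entropy `H(X)` in bits. -/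
noncomputable def entropy (p : Ω → ℝ) (X : Ω → α) : ℝ :=
  ∑ a, -(prob p {ω | X ω = a} * Real.logb 2 (prob p {ω | X ω = a}))

/-- The entropy `H(X | F)` in bits of the conditional law of `X` given the event `F`. -/
noncomputable def entropyGiven (p : Ω → ℝ) (X : Ω → α) (F : Set Ω) : ℝ :=
  ∑ a, -(condProb p {ω | X ω = a} F * Real.logb 2 (condProb p {ω | X ω = a} F))

/-- The conditional entropy `H(X | W) = ∑ w, P(W = w) H(X | W = w)` in bits. -/
noncomputable def condEntropy (p : Ω → ℝ) (X : Ω → α) (W : Ω → γ) : ℝ :=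
  ∑ w, prob p {ω | W ω = w} * entropyGiven p X {ω | W ω = w}

/-- The mutual information `I(X; Y) = H(X) - H(X | Y)` in bits. -/
noncomputable def mutualInfo (p : Ω → ℝ) (X : Ω → α) (Y : Ω → β) : ℝ :=
  entropy p X - condEntropy p X Y

/-- The conditional mutual information `I(X; Y | W) = H(X | W) - H(X | Y, W)` in bits. -/
noncomputable def condMutualInfo (p : Ω → ℝ) (X : Ω → α) (Y : Ω → β) (W : Ω → γ) : ℝ :=
  condEntropy p X W - condEntropy p X (fun ω => (Y ω, W ω))

end Information

/-! ### A binary linear code on the binary erasure channel -/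

section Channel

variable {n : ℕ}

/-- Transition probabilities `P(y | x)` of the BEC(`ε`); the output `none` is the erasure symbol. -/
noncomputable def becTransition (ε : ℝ) (x : ZMod 2) : Option (ZMod 2) → ℝ
  | none => ε
  | some b => if b = x then 1 - ε else 0

open Classical in
/-- The joint law of `(X, Y)`: `X` is uniform on the code `C`, and `Y` is the output of `n`
independent uses of the BEC(`ε`) with input `X`. -/
noncomputable def becLaw (C : Submodule (ZMod 2) (Fin n → ZMod 2)) (ε : ℝ)
    (ω : (Fin n → ZMod 2) × (Fin n → Option (ZMod 2))) : ℝ :=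
  (if ω.1 ∈ C then (Nat.card C : ℝ)⁻¹ else 0) * ∏ k, becTransition ε (ω.1 k) (ω.2 k)

/-- The random variable `X_i`. -/
def bitX (i : Fin n) (ω : (Fin n → ZMod 2) × (Fin n → Option (ZMod 2))) : ZMod 2 :=
  ω.1 i

/-- The random vector `Y_{∼i}`: all channel outputs except the one at `i`. -/
def outExcept (i : Fin n) (ω : (Fin n → ZMod 2) × (Fin n → Option (ZMod 2))) :
    {k : Fin n // k ≠ i} → Option (ZMod 2) :=
  fun k => ω.2 k

/-- The random vector `Y_{∼i,j}`: all channel outputs except those at `i` and `j`. -/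
def outExceptTwo (i j : Fin n) (ω : (Fin n → ZMod 2) × (Fin n → Option (ZMod 2))) :
    {k : Fin n // k ≠ i ∧ k ≠ j} → Option (ZMod 2) :=
  fun k => ω.2 k

end Channel

/-! ### Covered codewords and the erasure pattern -/

section Patterns

variable {n : ℕ}

/-- The codewords `c` of `C` with `(c_i, c_j) = (a, b)`. -/
def typeCode (C : Submodule (ZMod 2) (Fin n → ZMod 2)) (i j : Fin n) (a b : ZMod 2) :
    Set (Fin n → ZMod 2) :=
  {c | c ∈ C ∧ c i = a ∧ c j = b}

/-- The elements of `A` that are covered by `z`: the support of `z` contains theirs. -/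
def coveredBy (A : Set (Fin n → ZMod 2)) (z : Fin n → ZMod 2) : Set (Fin n → ZMod 2) :=
  {a | a ∈ A ∧ ∀ k, a k = 1 → z k = 1}

/-- The patterns that cover a codeword of type `(0, 1)` and none of types `(1, 0)`, `(1, 1)`. -/
def only01 (C : Submodule (ZMod 2) (Fin n → ZMod 2)) (i j : Fin n) : Set (Fin n → ZMod 2) :=
  {z | (coveredBy (typeCode C i j 0 1) z).Nonempty ∧
    coveredBy (typeCode C i j 1 0) z = ∅ ∧ coveredBy (typeCode C i j 1 1) z = ∅}

/-- The patterns that cover a codeword of type `(1, 0)` and none of types `(0, 1)`, `(1, 1)`. -/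
def only10 (C : Submodule (ZMod 2) (Fin n → ZMod 2)) (i j : Fin n) : Set (Fin n → ZMod 2) :=
  {z | (coveredBy (typeCode C i j 1 0) z).Nonempty ∧
    coveredBy (typeCode C i j 0 1) z = ∅ ∧ coveredBy (typeCode C i j 1 1) z = ∅}

/-- The patterns that cover a codeword of type `(1, 1)` and none of types `(0, 1)`, `(1, 0)`. -/
def only11 (C : Submodule (ZMod 2) (Fin n → ZMod 2)) (i j : Fin n) : Set (Fin n → ZMod 2) :=
  {z | (coveredBy (typeCode C i j 1 1) z).Nonempty ∧
    coveredBy (typeCode C i j 0 1) z = ∅ ∧ coveredBy (typeCode C i j 1 0) z = ∅}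

/-- The law of the erasure pattern `Z` in which `i` and `j` are erased and every other
coordinate is erased independently with probability `ε` (`1` means erased). -/
noncomputable def patternLaw (ε : ℝ) (i j : Fin n) (z : Fin n → ZMod 2) : ℝ :=
  ∏ k, if k = i ∨ k = j then (if z k = 1 then 1 else 0) else (if z k = 1 then ε else 1 - ε)

/-- The quantity `α_{ij}^ε`: the conditional probability that `Z` covers, among the nonzero types
`(0, 1)`, `(1, 0)`, `(1, 1)`, only `(1, 1)`, given that it covers exactly one of them. -/
noncomputable def alphaCoeff (C : Submodule (ZMod 2) (Fin n → ZMod 2)) (ε : ℝ) (i j : Fin n) : ℝ :=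
  condProb (patternLaw ε i j) (only11 C i j) (only01 C i j ∪ only10 C i j ∪ only11 C i j)

end Patterns

/-! Shifting the channel by a codeword preserves its law. Hence, given an observation, a code bit is
fair if some codeword with a one at that bit is invisible to the observation, and determined
otherwise: each conditional entropy is the probability of an erasure event (`condEntropy_bitX`). The
conditional mutual information is therefore exactly P(Z ∈ B₄) (`condMutualInfo_eq_prob_only11`), and
what remains is P(U) ≥ δ/(8√n) for U = B₂ ∪ B₃ ∪ B₄.

Let A be the increasing event that some nonzero type is covered, and a = P(A). A boundary pattern of
A lies in U (`mem_exactlyOne_of_boundary`), and the boundary has probability at least a(1-a)/(2√n)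
(`le_sqrt_mul_prob_boundary`, from `isoperimetry`). Finally, h = H(X_i | Y_{∼i}) satisfies h ≤ a ≤
P(U) + h, and h ∈ (δ, 1-δ). So either P(U) is already large or a is bounded away from 0 and 1. -/

open scoped Classical in
theorem prob_eq_sum_ite {Ω : Type*} [Fintype Ω] (p : Ω → ℝ) (E : Set Ω) :
    prob p E = ∑ ω, if ω ∈ E then p ω else 0 := by
  unfold prob
  exact Finset.sum_congr rfl fun ω _ => by split_ifs <;> rfl

/-! ### Elementary finite probability -/

section Prob

variable {Ω γ : Type*} [Fintype Ω] [Fintype γ] {p : Ω → ℝ} {E F : Set Ω}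

theorem prob_nonneg (hp : ∀ ω, 0 ≤ p ω) (E : Set Ω) : 0 ≤ prob p E := by
  unfold prob
  exact Finset.sum_nonneg fun ω _ => by split_ifs <;> simp [hp]

theorem prob_mono (hp : ∀ ω, 0 ≤ p ω) (h : E ⊆ F) : prob p E ≤ prob p F := by
  unfold prob
  refine Finset.sum_le_sum fun ω _ => ?_
  by_cases hE : ω ∈ E
  · simp [hE, h hE]
  · by_cases hF : ω ∈ F <;> simp [hE, hF, hp]

theorem prob_union_le (hp : ∀ ω, 0 ≤ p ω) (E F : Set Ω) :
    prob p (E ∪ F) ≤ prob p E + prob p F := by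
  unfold prob
  rw [← Finset.sum_add_distrib]
  refine Finset.sum_le_sum fun ω _ => ?_
  by_cases hE : ω ∈ E <;> by_cases hF : ω ∈ F <;> simp [hE, hF, hp]

theorem prob_union_of_disjoint (h : Disjoint E F) :
    prob p (E ∪ F) = prob p E + prob p F := by
  unfold prob
  rw [← Finset.sum_add_distrib]
  refine Finset.sum_congr rfl fun ω _ => ?_
  by_cases hE : ω ∈ E
  · simp [hE, Set.disjoint_left.1 h hE]
  · by_cases hF : ω ∈ F <;> simp [hE, hF]

theorem prob_eq_zero (h : ∀ ω ∈ E, p ω = 0) : prob p E = 0 := by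
  unfold prob
  refine Finset.sum_eq_zero fun ω _ => ?_
  by_cases hE : ω ∈ E <;> simp [hE, h]

theorem prob_univ : prob p Set.univ = ∑ ω, p ω := by
  simp [prob]

theorem sum_prob_fiber (p : Ω → ℝ) (W : Ω → γ) (E : Set Ω) :
    ∑ w, prob p ({ω | W ω = w} ∩ E) = prob p E := by
  classical
  simp only [prob_eq_sum_ite]
  rw [Finset.sum_comm]
  refine Finset.sum_congr rfl fun ω _ => ?_
  by_cases hE : ω ∈ E <;> simp [hE]

theorem prob_preimage_equiv (σ : Ω ≃ Ω) (hσ : ∀ ω, p (σ ω) = p ω) (E : Set Ω) :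
    prob p (σ ⁻¹' E) = prob p E := by
  classical
  simp only [prob_eq_sum_ite]
  rw [← Equiv.sum_comp σ fun ω => if ω ∈ E then p ω else 0]
  simp [hσ]

end Prob

/-! ### Entropy of a bit that is fair or determined on each fibre -/

section BitEntropy

variable {Ω γ : Type*} [Fintype Ω] [Fintype γ] {p : Ω → ℝ}

theorem sum_zmod_two {M : Type*} [AddCommMonoid M] (f : ZMod 2 → M) : ∑ b, f b = f 0 + f 1 :=
  Fin.sum_univ_two f

theorem zmod_two_eq_zero_or_one (b : ZMod 2) : b = 0 ∨ b = 1 := by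
  revert b; decide

theorem prob_bit_add (p : Ω → ℝ) (X : Ω → ZMod 2) (F : Set Ω) :
    prob p ({ω | X ω = 0} ∩ F) + prob p ({ω | X ω = 1} ∩ F) = prob p F := by
  rw [← sum_prob_fiber p X F, sum_zmod_two]

theorem entropyGiven_eq_one {X : Ω → ZMod 2} {F : Set Ω} (hF : prob p F ≠ 0)
    (h : prob p ({ω | X ω = 0} ∩ F) = prob p ({ω | X ω = 1} ∩ F)) :
    entropyGiven p X F = 1 := by
  have hs := prob_bit_add p X F
  have h0 : condProb p {ω | X ω = 0} F = 2⁻¹ := by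
    unfold condProb
    field_simp
    linarith
  have h1 : condProb p {ω | X ω = 1} F = 2⁻¹ := by
    unfold condProb
    field_simp
    linarith
  unfold entropyGiven
  rw [sum_zmod_two, h0, h1, Real.logb_inv, Real.logb_self_eq_one one_lt_two]
  norm_num

theorem entropyGiven_eq_zero {X : Ω → ZMod 2} {F : Set Ω} (hF : prob p F ≠ 0)
    (h : prob p ({ω | X ω = 0} ∩ F) = 0 ∨ prob p ({ω | X ω = 1} ∩ F) = 0) :
    entropyGiven p X F = 0 := by
  have hs := prob_bit_add p X F
  unfold entropyGiven condProb
  rw [sum_zmod_two]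
  rcases h with h | h
  · rw [h, zero_add] at hs
    rw [h, hs, div_self hF]
    simp
  · rw [h, add_zero] at hs
    rw [h, hs, div_self hF]
    simp

/-- If, given each value of `W`, the bit `X` is fair on the `W`-measurable event `E` and
deterministic off `E`, then `H(X | W) = P(E)`. -/
theorem condEntropy_bit_eq_prob {X : Ω → ZMod 2} {W : Ω → γ} {E : Set Ω}
    (hE : ∀ ω ω', W ω = W ω' → ω ∈ E → ω' ∈ E)
    (hfair : ∀ ω ∈ E, prob p ({ω' | X ω' = 0} ∩ {ω' | W ω' = W ω}) =
      prob p ({ω' | X ω' = 1} ∩ {ω' | W ω' = W ω}))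
    (hdet : ∀ ω ω', p ω ≠ 0 → p ω' ≠ 0 → W ω = W ω' → X ω ≠ X ω' → ω ∈ E) :
    condEntropy p X W = prob p E := by
  unfold condEntropy
  rw [← sum_prob_fiber p W E]
  refine Finset.sum_congr rfl fun w _ => ?_
  by_cases hex : ∃ ω ∈ E, W ω = w
  · obtain ⟨ω, hω, rfl⟩ := hex
    have hsub : {ω' | W ω' = W ω} ∩ E = {ω' | W ω' = W ω} :=
      Set.inter_eq_left.2 fun ω' (h : W ω' = W ω) => hE ω ω' h.symm hω
    rw [hsub]
    by_cases h0 : prob p {ω' | W ω' = W ω} = 0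
    · rw [h0, zero_mul]
    · rw [entropyGiven_eq_one h0 (hfair ω hω), mul_one]
  · push Not at hex
    have hemp : {ω' | W ω' = w} ∩ E = ∅ := by
      ext ω'
      simp only [Set.mem_inter_iff, Set.mem_ofPred_eq, Set.mem_empty_iff_false, iff_false]
      exact fun h => hex ω' h.2 h.1
    rw [hemp, prob_eq_zero (E := ∅) (by simp)]
    by_cases h0 : prob p {ω' | W ω' = w} = 0
    · rw [h0, zero_mul]
    · rw [entropyGiven_eq_zero h0, mul_zero]
      -- If both bit values had mass on this fibre, `hdet` would place a point of the fibre in `E`.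
      by_contra! hne
      obtain ⟨ω, hω, hpω⟩ : ∃ ω ∈ {ω' | X ω' = 0} ∩ {ω' | W ω' = w}, p ω ≠ 0 := by
        by_contra! hc
        exact hne.1 (prob_eq_zero hc)
      obtain ⟨ω', hω', hpω'⟩ : ∃ ω ∈ {ω' | X ω' = 1} ∩ {ω' | W ω' = w}, p ω ≠ 0 := by
        by_contra! hc
        exact hne.2 (prob_eq_zero hc)
      have hX0 : X ω = 0 := hω.1
      have hX1 : X ω' = 1 := hω'.1
      have hW : W ω = w := hω.2
      have hW' : W ω' = w := hω'.2
      refine hex ω (hdet ω ω' hpω hpω' (hW.trans hW'.symm) ?_) hW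
      rw [hX0, hX1]
      decide

end BitEntropy

/-! ### Isoperimetry for increasing events on the biased cube -/

section Isoperimetry

/-- The law of independent bits, the `k`-th of which is `1` with probability `p k`. -/
noncomputable def prodLaw {n : ℕ} (p : Fin n → ℝ) (z : Fin n → ZMod 2) : ℝ :=
  ∏ k, if z k = 1 then p k else 1 - p k

open Classical in
/-- The number of ones of `z ∈ A` whose removal leads out of `A`. -/
noncomputable def pivotCount {n : ℕ} (A : Set (Fin n → ZMod 2)) (z : Fin n → ZMod 2) : ℝ :=
  ∑ k, if z ∈ A ∧ z k = 1 ∧ Function.update z k 0 ∉ A then 1 else 0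

/-- `A` is closed under enlarging supports. -/
def IsIncreasing {n : ℕ} (A : Set (Fin n → ZMod 2)) : Prop :=
  ∀ z ∈ A, ∀ z', (∀ k, z k = 1 → z' k = 1) → z' ∈ A

variable {n : ℕ}

theorem prodLaw_nonneg {p : Fin n → ℝ} (h0 : ∀ k, 0 ≤ p k) (h1 : ∀ k, p k ≤ 1)
    (z : Fin n → ZMod 2) : 0 ≤ prodLaw p z :=
  Finset.prod_nonneg fun k _ => by
    split_ifs
    · exact h0 k
    · linarith [h1 k]

theorem sum_fin_succ_zmod_two (f : (Fin (n + 1) → ZMod 2) → ℝ) :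
    ∑ z, f z = (∑ z : Fin n → ZMod 2, f (Fin.cons 0 z)) +
      ∑ z : Fin n → ZMod 2, f (Fin.cons 1 z) := by
  rw [← (Fin.consEquiv fun _ => ZMod 2).sum_comp, Fintype.sum_prod_type, sum_zmod_two]
  rfl

theorem prodLaw_cons (p : Fin (n + 1) → ℝ) (b : ZMod 2) (z : Fin n → ZMod 2) :
    prodLaw p (Fin.cons b z) =
      (if b = 1 then p 0 else 1 - p 0) * prodLaw (fun k => p k.succ) z := by
  simp [prodLaw, Fin.prod_univ_succ]

theorem sum_prodLaw (p : Fin n → ℝ) : ∑ z, prodLaw p z = 1 := by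
  induction n with
  | zero => simp [prodLaw]
  | succ n ih =>
    rw [sum_fin_succ_zmod_two]
    simp only [prodLaw_cons, ← Finset.mul_sum, ih]
    simp

theorem prob_prodLaw_le_one {p : Fin n → ℝ} (h0 : ∀ k, 0 ≤ p k) (h1 : ∀ k, p k ≤ 1)
    (A : Set (Fin n → ZMod 2)) : prob (prodLaw p) A ≤ 1 := by
  rw [← sum_prodLaw p, ← prob_univ]
  exact prob_mono (prodLaw_nonneg h0 h1) (Set.subset_univ A)

theorem prob_prodLaw_succ (p : Fin (n + 1) → ℝ) (A : Set (Fin (n + 1) → ZMod 2)) :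
    prob (prodLaw p) A =
      (1 - p 0) * prob (prodLaw fun k => p k.succ) {z | Fin.cons 0 z ∈ A} +
        p 0 * prob (prodLaw fun k => p k.succ) {z | Fin.cons 1 z ∈ A} := by
  classical
  simp only [prob_eq_sum_ite, sum_fin_succ_zmod_two, prodLaw_cons, Finset.mul_sum]
  simp

theorem pivotCount_cons_zero (A : Set (Fin (n + 1) → ZMod 2)) (z : Fin n → ZMod 2) :
    pivotCount A (Fin.cons 0 z) =
      pivotCount {z | Fin.cons 0 z ∈ A} z := by
  classical
  rw [pivotCount, Fin.sum_univ_succ, if_neg (by simp), zero_add, pivotCount]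
  refine Finset.sum_congr rfl fun k _ => ?_
  simp only [Fin.cons_update, Fin.cons_succ, Set.mem_ofPred_eq]

-- The new coordinate is pivotal exactly on the difference of the two sections; this supplies the
-- squared term in the two-point inequality.
open Classical in
theorem pivotCount_cons_one (A : Set (Fin (n + 1) → ZMod 2)) (z : Fin n → ZMod 2) :
    pivotCount A (Fin.cons 1 z) = pivotCount {z | Fin.cons 1 z ∈ A} z +
      if z ∈ {z | Fin.cons 1 z ∈ A} \ {z | Fin.cons 0 z ∈ A} then 1 else 0 := by
  simp only [pivotCount, Fin.sum_univ_succ, Fin.cons_update, Fin.update_cons_zero, Fin.cons_zero,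
    Fin.cons_succ, Set.mem_ofPred_eq, Set.mem_sdiff, true_and]
  rw [add_comm]

theorem pivotCount_nonneg (A : Set (Fin n → ZMod 2)) (z : Fin n → ZMod 2) :
    0 ≤ pivotCount A z :=
  Finset.sum_nonneg fun k _ => by split_ifs <;> norm_num

theorem pivotCount_le (A : Set (Fin n → ZMod 2)) (z : Fin n → ZMod 2) :
    pivotCount A z ≤ n := by
  classical
  calc pivotCount A z ≤ ∑ _k : Fin n, (1 : ℝ) :=
        Finset.sum_le_sum fun k _ => by split_ifs <;> norm_num
    _ = n := by simp

/-- Minkowski's inequality for the Euclidean norm on the plane. -/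
theorem sqrt_sq_add_sq_le_sum {ι : Type*} [Fintype ι] (w u v : ι → ℝ) (hw : ∀ x, 0 ≤ w x) :
    √((∑ x, w x * u x) ^ 2 + (∑ x, w x * v x) ^ 2) ≤ ∑ x, w x * √(u x ^ 2 + v x ^ 2) := by
  have h := norm_sum_le Finset.univ fun x => (w x : ℂ) * (⟨u x, v x⟩ : ℂ)
  have hl : ∑ x, (w x : ℂ) * (⟨u x, v x⟩ : ℂ) = ⟨∑ x, w x * u x, ∑ x, w x * v x⟩ := by
    apply Complex.ext <;> simp
  rw [hl] at h
  simpa [Complex.norm_def, Complex.normSq_mk, ← pow_two, abs_of_nonneg, hw, Real.sqrt_sq_eq_abs,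
    Complex.normSq_ofReal] using h

/-- With J(x) = x(1-x)/2, the concavity defect of J at the mixture is p(1-p)(b-a)²/2, and the square
root exceeds J(b) by at least (b-a)²/2. This is the inductive step of `isoperimetry`. -/
theorem two_point_isoperimetry {p a b : ℝ} (hp0 : 0 ≤ p) (ha : 0 ≤ a) (hab : a ≤ b)
    (hb : b ≤ 1) {s : ℝ} (hs : 1 / 2 * (b * (1 - b)) ≤ s) :
    1 / 2 * (((1 - p) * a + p * b) * (1 - ((1 - p) * a + p * b))) ≤
      (1 - p) * (1 / 2 * (a * (1 - a))) + p * √(s ^ 2 + (b - a) ^ 2) := by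
  have hJ0 : 0 ≤ 1 / 2 * (b * (1 - b)) := by nlinarith
  have hJ1 : 1 / 2 * (b * (1 - b)) ≤ 1 / 8 := by nlinarith [sq_nonneg (b - 1 / 2)]
  have hd1 : (b - a) ^ 2 ≤ 1 := by nlinarith
  have hd0 : 0 ≤ (b - a) ^ 2 := sq_nonneg _
  have key : 1 / 2 * (b * (1 - b)) + (b - a) ^ 2 / 2 ≤ √(s ^ 2 + (b - a) ^ 2) := by
    apply Real.le_sqrt_of_sq_le
    -- With d = b - a, the square of the left side is J² + Jd² + d⁴/4, and J ≤ 1/8, d² ≤ 1 bound it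
    -- by J² + d².
    nlinarith [mul_nonneg hd0 hJ0, mul_nonneg hd0 (sub_nonneg.2 hJ1),
      mul_nonneg hd0 (sub_nonneg.2 hd1)]
  have h1 := mul_le_mul_of_nonneg_left key hp0
  nlinarith [mul_nonneg (mul_nonneg hp0 hp0) hd0]

/-- A dimension-free Margulis–Talagrand inequality for increasing events, uniform in the biases. -/
theorem isoperimetry {p : Fin n → ℝ} (h0 : ∀ k, 0 ≤ p k) (h1 : ∀ k, p k ≤ 1)
    {A : Set (Fin n → ZMod 2)} (hA : IsIncreasing A) :
    1 / 2 * (prob (prodLaw p) A * (1 - prob (prodLaw p) A)) ≤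
      ∑ z, prodLaw p z * √(pivotCount A z) := by
  classical
  induction n with
  | zero =>
    -- On a one-point space every event has probability 0 or 1.
    have : prob (prodLaw p) A * (1 - prob (prodLaw p) A) = 0 := by
      rw [prob_eq_sum_ite, Fintype.sum_unique]
      split_ifs <;> simp [prodLaw]
    rw [this, mul_zero]
    exact Finset.sum_nonneg fun z _ => mul_nonneg (prodLaw_nonneg h0 h1 z) (Real.sqrt_nonneg _)
  | succ n ih =>
    set q : Fin n → ℝ := fun k => p k.succ with hq
    set A₀ : Set (Fin n → ZMod 2) := {z | Fin.cons 0 z ∈ A} with hA₀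
    set A₁ : Set (Fin n → ZMod 2) := {z | Fin.cons 1 z ∈ A} with hA₁
    have hq0 : ∀ k, 0 ≤ q k := fun k => h0 _
    have hq1 : ∀ k, q k ≤ 1 := fun k => h1 _
    have hinc (b : ZMod 2) :
        IsIncreasing {z : Fin n → ZMod 2 | (Fin.cons b z : Fin (n + 1) → ZMod 2) ∈ A} := by
      intro z hz z' hzz'
      refine hA _ hz _ fun k => ?_
      refine Fin.cases ?_ (fun k => ?_) k
      · simp
      · simpa using hzz' k
    have hsub : A₀ ⊆ A₁ := by
      intro z hz
      refine hA _ hz _ fun k => ?_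
      refine Fin.cases ?_ (fun k => ?_) k <;> simp
    have hpos := prodLaw_nonneg hq0 hq1
    have ih0 := ih hq0 hq1 (hinc 0)
    have ih1 := ih hq0 hq1 (hinc 1)
    have hdiff : prob (prodLaw q) A₁ - prob (prodLaw q) A₀ =
        ∑ z, prodLaw q z * (if z ∈ A₁ \ A₀ then 1 else 0) := by
      have hu : prob (prodLaw q) A₁ = prob (prodLaw q) A₀ + prob (prodLaw q) (A₁ \ A₀) := by
        rw [← prob_union_of_disjoint Set.disjoint_sdiff_right, Set.union_sdiff_cancel hsub]
      rw [hu, add_sub_cancel_left, prob_eq_sum_ite]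
      simp
    -- Minkowski moves the expectation inside the square root, so the induction hypothesis for `A₁`
    -- can serve as `s`.
    have hmink := sqrt_sq_add_sq_le_sum (prodLaw q) (fun z => √(pivotCount A₁ z))
      (fun z => if z ∈ A₁ \ A₀ then 1 else 0) hpos
    rw [← hdiff] at hmink
    have htp := two_point_isoperimetry (h0 0) (prob_nonneg hpos A₀) (prob_mono hpos hsub)
      (prob_prodLaw_le_one hq0 hq1 A₁) ih1
    have hsplit : ∑ z, prodLaw p z * √(pivotCount A z) =
        (1 - p 0) * ∑ z, prodLaw q z * √(pivotCount A₀ z) +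
          p 0 * ∑ z, prodLaw q z * √(√(pivotCount A₁ z) ^ 2 +
            (if z ∈ A₁ \ A₀ then (1 : ℝ) else 0) ^ 2) := by
      rw [sum_fin_succ_zmod_two, Finset.mul_sum, Finset.mul_sum]
      congr 1
      · refine Finset.sum_congr rfl fun z _ => ?_
        rw [prodLaw_cons, pivotCount_cons_zero, if_neg (by decide), mul_assoc]
      · refine Finset.sum_congr rfl fun z _ => ?_
        rw [prodLaw_cons, pivotCount_cons_one, if_pos rfl, mul_assoc,
          Real.sq_sqrt (pivotCount_nonneg _ _)]
        congr 4
        split_ifs <;> simp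
    rw [prob_prodLaw_succ, hsplit]
    refine htp.trans (add_le_add ?_ ?_)
    · exact mul_le_mul_of_nonneg_left ih0 (by linarith [h1 0])
    · exact mul_le_mul_of_nonneg_left hmink (h0 0)

/-- The inner vertex boundary of an increasing event has probability of order at least `1 / √n`. -/
theorem le_sqrt_mul_prob_boundary {p : Fin n → ℝ} (h0 : ∀ k, 0 ≤ p k) (h1 : ∀ k, p k ≤ 1)
    {A : Set (Fin n → ZMod 2)} (hA : IsIncreasing A) :
    1 / 2 * (prob (prodLaw p) A * (1 - prob (prodLaw p) A)) ≤
      √n * prob (prodLaw p) {z | z ∈ A ∧ ∃ k, z k = 1 ∧ Function.update z k 0 ∉ A} := by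
  classical
  refine (isoperimetry h0 h1 hA).trans ?_
  rw [prob_eq_sum_ite, Finset.mul_sum]
  refine Finset.sum_le_sum fun z _ => ?_
  split_ifs with h
  · rw [mul_comm]
    exact mul_le_mul_of_nonneg_right (Real.sqrt_le_sqrt (pivotCount_le A z))
      (prodLaw_nonneg h0 h1 z)
  · have : pivotCount A z = 0 := by
      refine Finset.sum_eq_zero fun k _ => if_neg fun hk => h ⟨hk.1, k, hk.2⟩
    simp [this]

end Isoperimetry

/-! ### Code-bit entropies through codeword shifts -/

section ErasureChannel

variable {n : ℕ}

/-- Adding the word `c` to both the input and the unerased outputs of the channel. -/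
def channelShift (c : Fin n → ZMod 2) :
    (Fin n → ZMod 2) × (Fin n → Option (ZMod 2)) ≃ (Fin n → ZMod 2) × (Fin n → Option (ZMod 2)) where
  toFun ω := (ω.1 + c, fun k => (ω.2 k).map (· + c k))
  invFun ω := (ω.1 + c, fun k => (ω.2 k).map (· + c k))
  left_inv ω := by
    ext k : 2
    · simp [add_assoc, CharTwo.add_self_eq_zero]
    · simp [Function.comp_def, add_assoc, CharTwo.add_self_eq_zero]
  right_inv ω := by
    ext k : 2
    · simp [add_assoc, CharTwo.add_self_eq_zero]
    · simp [Function.comp_def, add_assoc, CharTwo.add_self_eq_zero]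

theorem channelShift_channelShift (c : Fin n → ZMod 2)
    (ω : (Fin n → ZMod 2) × (Fin n → Option (ZMod 2))) :
    channelShift c (channelShift c ω) = ω :=
  (channelShift c).left_inv ω

theorem becTransition_shift (ε : ℝ) (x c : ZMod 2) (y : Option (ZMod 2)) :
    becTransition ε (x + c) (y.map (· + c)) = becTransition ε x y := by
  cases y <;> simp [becTransition]

theorem becTransition_nonneg {ε : ℝ} (h0 : 0 ≤ ε) (h1 : ε ≤ 1) (x : ZMod 2)
    (y : Option (ZMod 2)) : 0 ≤ becTransition ε x y := by
  cases y
  · exact h0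
  · simp only [becTransition]
    split_ifs <;> linarith

variable {C : Submodule (ZMod 2) (Fin n → ZMod 2)} {ε : ℝ}

theorem becLaw_nonneg (h0 : 0 ≤ ε) (h1 : ε ≤ 1)
    (ω : (Fin n → ZMod 2) × (Fin n → Option (ZMod 2))) : 0 ≤ becLaw C ε ω := by
  unfold becLaw
  refine mul_nonneg ?_ (Finset.prod_nonneg fun k _ => becTransition_nonneg h0 h1 _ _)
  split_ifs <;> positivity

theorem becLaw_channelShift {c : Fin n → ZMod 2} (hc : c ∈ C)
    (ω : (Fin n → ZMod 2) × (Fin n → Option (ZMod 2))) :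
    becLaw C ε (channelShift c ω) = becLaw C ε ω := by
  classical
  simp [becLaw, channelShift, becTransition_shift, C.add_mem_iff_left hc]

theorem mem_and_eq_of_becLaw_ne_zero {ω : (Fin n → ZMod 2) × (Fin n → Option (ZMod 2))}
    (h : becLaw C ε ω ≠ 0) : ω.1 ∈ C ∧ ∀ k, ω.2 k = none ∨ ω.2 k = some (ω.1 k) := by
  unfold becLaw at h
  refine ⟨?_, fun k => ?_⟩
  · by_contra hc
    simp [hc] at h
  · have hk := Finset.prod_ne_zero_iff.1 (right_ne_zero_of_mul h) k (Finset.mem_univ k)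
    cases hy : ω.2 k with
    | none => exact Or.inl rfl
    | some b =>
      right
      by_contra hb
      rw [hy] at hk
      exact hk (if_neg fun h => hb (congrArg some h))

/-- The entropy of a code bit given an observation `W` of the channel is the probability that some
codeword with a one at that bit is invisible to `W`. -/
theorem condEntropy_bitX {γ : Type*} [Fintype γ] (i : Fin n)
    {W : (Fin n → ZMod 2) × (Fin n → Option (ZMod 2)) → γ}
    (hequiv : ∀ c ω ω', W ω = W ω' → W (channelShift c ω) = W (channelShift c ω'))
    (hsep : ∀ ω ω', becLaw C ε ω ≠ 0 → becLaw C ε ω' ≠ 0 → W ω = W ω' →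
      W (channelShift (ω.1 + ω'.1) ω) = W ω) :
    condEntropy (becLaw C ε) (bitX i) W =
      prob (becLaw C ε) {ω | ∃ c ∈ C, c i = 1 ∧ W (channelShift c ω) = W ω} := by
  apply condEntropy_bit_eq_prob
  · rintro ω ω' h ⟨c, hc, hci, hcW⟩
    exact ⟨c, hc, hci, by rw [← hequiv c ω ω' h, hcW, h]⟩
  · rintro ω ⟨c, hc, hci, hcW⟩
    -- Shifting by the invisible `c` flips the bit and keeps the fibre of `W`.
    rw [← prob_preimage_equiv (channelShift c) (becLaw_channelShift hc)]
    congr 1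
    ext ω'
    have hbit : bitX i (channelShift c ω') = bitX i ω' + 1 := by
      simp [bitX, channelShift, hci]
    have hobs : W (channelShift c ω') = W ω ↔ W ω' = W ω := by
      constructor
      · intro h
        rw [← hcW] at h
        simpa [channelShift_channelShift] using hequiv c _ _ h
      · intro h
        rw [hequiv c _ _ h, hcW]
    simp only [Set.mem_preimage, Set.mem_inter_iff, Set.mem_ofPred_eq, hbit, hobs]
    refine and_congr_left fun _ => ?_
    generalize bitX i ω' = b
    revert b
    decide
  · intro ω ω' h h' hW hX
    have hm := mem_and_eq_of_becLaw_ne_zero h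
    have hm' := mem_and_eq_of_becLaw_ne_zero h'
    refine ⟨ω.1 + ω'.1, C.add_mem hm.1 hm'.1, ?_, hsep ω ω' h h' hW⟩
    have : ∀ a b : ZMod 2, a ≠ b → a + b = 1 := by decide
    exact this _ _ hX

theorem option_map_add_eq_self_iff (y : Option (ZMod 2)) (c : ZMod 2) :
    y.map (· + c) = y ↔ y = none ∨ c = 0 := by
  cases y <;> simp

/-- Equal outputs are either erased, or reveal equal inputs, so that the difference of the inputs
vanishes at `k`. -/
theorem option_map_add_eq_self_of_becLaw_ne_zero
    {ω ω' : (Fin n → ZMod 2) × (Fin n → Option (ZMod 2))} (h : becLaw C ε ω ≠ 0)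
    (h' : becLaw C ε ω' ≠ 0) {k : Fin n} (hk : ω.2 k = ω'.2 k) :
    (ω.2 k).map (· + (ω.1 + ω'.1) k) = ω.2 k := by
  rw [option_map_add_eq_self_iff]
  rcases (mem_and_eq_of_becLaw_ne_zero h).2 k with h1 | h1
  · exact Or.inl h1
  rcases (mem_and_eq_of_becLaw_ne_zero h').2 k with h2 | h2
  · exact Or.inl (hk.trans h2)
  right
  have : ω.1 k = ω'.1 k := Option.some_injective _ (h1.symm.trans (hk.trans h2))
  rw [Pi.add_apply, this, CharTwo.add_self_eq_zero]

theorem condEntropy_bitX_outExcept (i : Fin n) :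
    condEntropy (becLaw C ε) (bitX i) (outExcept i) =
      prob (becLaw C ε) {ω | ∃ c ∈ C, c i = 1 ∧ ∀ k, k ≠ i → ω.2 k = none ∨ c k = 0} := by
  rw [condEntropy_bitX]
  · simp only [funext_iff, Subtype.forall, outExcept, channelShift, Equiv.coe_fn_mk,
      option_map_add_eq_self_iff]
  · intro c ω ω' h
    ext1 k
    have hk : ω.2 k = ω'.2 k := congrFun h k
    simp [outExcept, channelShift, hk]
  · intro ω ω' h h' hW
    ext1 k
    exact option_map_add_eq_self_of_becLaw_ne_zero h h' (congrFun hW k)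

theorem condEntropy_bitX_outExceptTwo (i j : Fin n) :
    condEntropy (becLaw C ε) (bitX i) (outExceptTwo i j) =
      prob (becLaw C ε)
        {ω | ∃ c ∈ C, c i = 1 ∧ ∀ k, k ≠ i ∧ k ≠ j → ω.2 k = none ∨ c k = 0} := by
  rw [condEntropy_bitX]
  · simp only [funext_iff, Subtype.forall, outExceptTwo, channelShift, Equiv.coe_fn_mk,
      option_map_add_eq_self_iff]
  · intro c ω ω' h
    ext1 k
    have hk : ω.2 k = ω'.2 k := congrFun h k
    simp [outExceptTwo, channelShift, hk]
  · intro ω ω' h h' hW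
    ext1 k
    exact option_map_add_eq_self_of_becLaw_ne_zero h h' (congrFun hW k)

theorem condEntropy_bitX_bitX_outExceptTwo (i j : Fin n) :
    condEntropy (becLaw C ε) (bitX i) (fun ω => (bitX j ω, outExceptTwo i j ω)) =
      prob (becLaw C ε)
        {ω | ∃ c ∈ C, c i = 1 ∧ c j = 0 ∧ ∀ k, k ≠ i ∧ k ≠ j → ω.2 k = none ∨ c k = 0} := by
  rw [condEntropy_bitX]
  · simp only [Prod.mk.injEq, funext_iff, Subtype.forall, outExceptTwo, bitX, channelShift,
      Equiv.coe_fn_mk, option_map_add_eq_self_iff, Pi.add_apply, add_eq_left]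
  · intro c ω ω' h
    have hj : ω.1 j = ω'.1 j := congrArg Prod.fst h
    refine Prod.ext ?_ ?_
    · simp [bitX, channelShift, hj]
    · ext1 k
      have hk : ω.2 k = ω'.2 k := congrFun (congrArg Prod.snd h) k
      simp [outExceptTwo, channelShift, hk]
  · intro ω ω' h h' hW
    have hj : ω.1 j = ω'.1 j := congrArg Prod.fst hW
    refine Prod.ext ?_ ?_
    · simp [bitX, channelShift, hj, CharTwo.add_self_eq_zero]
    · ext1 k
      exact option_map_add_eq_self_of_becLaw_ne_zero h h' (congrFun (congrArg Prod.snd hW) k)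

/-! ### From channel outputs to erasure patterns -/

/-- The erasure pattern of the channel output `y`, with `i` and `j` also counted as erased. -/
def erasurePattern (i j : Fin n) (y : Fin n → Option (ZMod 2)) : Fin n → ZMod 2 :=
  fun k => if k = i ∨ k = j ∨ y k = none then 1 else 0

theorem sum_becTransition (ε : ℝ) (x : ZMod 2) (f : Option (ZMod 2) → ℝ) :
    ∑ y, f y * becTransition ε x y = f none * ε + f (some x) * (1 - ε) := by
  simp [Fintype.sum_option, becTransition]

theorem sum_prod_becTransition_erasurePattern (i j : Fin n) (ε : ℝ) (x z : Fin n → ZMod 2) :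
    ∑ y, (if erasurePattern i j y = z then ∏ k, becTransition ε (x k) (y k) else 0) =
      patternLaw ε i j z := by
  have h (y : Fin n → Option (ZMod 2)) :
      (if erasurePattern i j y = z then ∏ k, becTransition ε (x k) (y k) else 0) =
        ∏ k, (if (if k = i ∨ k = j ∨ y k = none then 1 else 0) = z k then (1 : ℝ) else 0) *
          becTransition ε (x k) (y k) := by
    rw [Finset.prod_mul_distrib]
    split_ifs with hz
    · refine (one_mul _).symm.trans (congrArg (· * _) (Finset.prod_eq_one fun k _ => ?_).symm)
      exact if_pos (congrFun hz k)
    · obtain ⟨k, hk⟩ := Function.ne_iff.1 hz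
      rw [Finset.prod_eq_zero (Finset.mem_univ k) (if_neg hk), zero_mul]
  simp only [h]
  rw [← Fintype.prod_sum fun k (y : Option (ZMod 2)) =>
    (if (if k = i ∨ k = j ∨ y = none then 1 else 0) = z k then (1 : ℝ) else 0) *
      becTransition ε (x k) y]
  unfold patternLaw
  refine Finset.prod_congr rfl fun k _ => ?_
  rw [sum_becTransition]
  simp only [← or_assoc]
  generalize z k = b
  rcases zmod_two_eq_zero_or_one b with rfl | rfl <;> by_cases hk : k = i ∨ k = j <;> simp [hk]

/-- Given the input, the pattern has a law that does not depend on that input, so the codeword sums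
out. -/
theorem prob_becLaw_erasurePattern (i j : Fin n) (S : Set (Fin n → ZMod 2)) :
    prob (becLaw C ε) {ω | erasurePattern i j ω.2 ∈ S} = prob (patternLaw ε i j) S := by
  classical
  have hcode : ∑ x : Fin n → ZMod 2, (if x ∈ C then (Nat.card C : ℝ)⁻¹ else 0) = 1 := by
    rw [← Finset.sum_filter, Finset.sum_const, nsmul_eq_mul, ← Fintype.card_subtype,
      ← Nat.card_eq_fintype_card]
    exact mul_inv_cancel₀ (Nat.cast_ne_zero.2 Nat.card_pos.ne')
  have hx (x : Fin n → ZMod 2) :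
      ∑ y, (if erasurePattern i j y ∈ S then ∏ k, becTransition ε (x k) (y k) else 0) =
        prob (patternLaw ε i j) S := by
    rw [prob_eq_sum_ite]
    simp only [← sum_prod_becTransition_erasurePattern i j ε x]
    have (z : Fin n → ZMod 2) : (if z ∈ S then
        ∑ y, (if erasurePattern i j y = z then ∏ k, becTransition ε (x k) (y k) else 0) else 0) =
        ∑ y, if erasurePattern i j y = z then
          (if erasurePattern i j y ∈ S then ∏ k, becTransition ε (x k) (y k) else 0) else 0 := by
      split_ifs with hz
      · exact Finset.sum_congr rfl fun y _ => by
          split_ifs with h1 h2 <;> first | rfl | exact absurd (h1 ▸ hz) h2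
      · refine (Finset.sum_eq_zero fun y _ => ?_).symm
        split_ifs with h1 h2 <;> first | rfl | exact absurd (h1 ▸ h2) hz
    simp only [this]
    rw [Finset.sum_comm]
    simp
  rw [prob_eq_sum_ite, Fintype.sum_prod_type]
  calc _ = ∑ x : Fin n → ZMod 2, (if x ∈ C then (Nat.card C : ℝ)⁻¹ else 0) *
        ∑ y, (if erasurePattern i j y ∈ S then ∏ k, becTransition ε (x k) (y k) else 0) := by
        refine Finset.sum_congr rfl fun x _ => ?_
        rw [Finset.mul_sum]
        refine Finset.sum_congr rfl fun y _ => ?_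
        simp only [Set.mem_ofPred_eq, becLaw, mul_ite, mul_zero]
    _ = _ := by
        simp only [hx, ← Finset.sum_mul, hcode, one_mul]

theorem sum_becLaw (C : Submodule (ZMod 2) (Fin n → ZMod 2)) (ε : ℝ) (i j : Fin n) :
    ∑ ω, becLaw C ε ω = ∑ z, patternLaw ε i j z := by
  rw [← prob_univ, ← prob_univ, ← prob_becLaw_erasurePattern (C := C)]
  simp

end ErasureChannel

/-! ### Covered types, the boundary, and the final estimates -/

section Patterns

variable {n : ℕ} {C : Submodule (ZMod 2) (Fin n → ZMod 2)} {ε : ℝ} {i j : Fin n}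

theorem coveredBy_typeCode_nonempty_iff {a b : ZMod 2} {z : Fin n → ZMod 2} :
    (coveredBy (typeCode C i j a b) z).Nonempty ↔
      ∃ c ∈ C, c i = a ∧ c j = b ∧ ∀ k, c k = 1 → z k = 1 := by
  simp [Set.Nonempty, coveredBy, typeCode, and_assoc]

/-- The support of a sum lies in the union of the supports. Hence the covered types form a subspace
of 𝔽₂², and the number of nonzero ones is 0, 1 or 3. -/
theorem coveredBy_typeCode_nonempty_add {a b a' b' : ZMod 2} {z : Fin n → ZMod 2}
    (h : (coveredBy (typeCode C i j a b) z).Nonempty)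
    (h' : (coveredBy (typeCode C i j a' b') z).Nonempty) :
    (coveredBy (typeCode C i j (a + a') (b + b')) z).Nonempty := by
  rw [coveredBy_typeCode_nonempty_iff] at *
  obtain ⟨c, hc, rfl, rfl, hz⟩ := h
  obtain ⟨c', hc', rfl, rfl, hz'⟩ := h'
  refine ⟨c + c', C.add_mem hc hc', rfl, rfl, fun k hk => ?_⟩
  rcases zmod_two_eq_zero_or_one (c k) with h0 | h1
  · rw [Pi.add_apply, h0, zero_add] at hk
    exact hz' k hk
  · exact hz k h1

theorem mem_exactlyOne_iff {z : Fin n → ZMod 2} :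
    z ∈ only01 C i j ∪ only10 C i j ∪ only11 C i j ↔
      ((coveredBy (typeCode C i j 0 1) z).Nonempty ∨
        (coveredBy (typeCode C i j 1 0) z).Nonempty ∨
        (coveredBy (typeCode C i j 1 1) z).Nonempty) ∧
      ¬((coveredBy (typeCode C i j 0 1) z).Nonempty ∧
        (coveredBy (typeCode C i j 1 0) z).Nonempty) := by
  have h1 := @coveredBy_typeCode_nonempty_add n C i j 0 1 1 0 z
  have h2 := @coveredBy_typeCode_nonempty_add n C i j 0 1 1 1 z
  have h3 := @coveredBy_typeCode_nonempty_add n C i j 1 0 1 1 z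
  simp only [zero_add, add_zero, CharTwo.add_self_eq_zero] at h1 h2 h3
  simp only [only01, only10, only11, Set.mem_union, Set.mem_ofPred_eq,
    ← Set.not_nonempty_iff_eq_empty]
  tauto

theorem mem_only11_iff {z : Fin n → ZMod 2} :
    z ∈ only11 C i j ↔ (coveredBy (typeCode C i j 1 1) z).Nonempty ∧
      ¬(coveredBy (typeCode C i j 1 0) z).Nonempty := by
  have h2 := @coveredBy_typeCode_nonempty_add n C i j 0 1 1 1 z
  simp only [zero_add, CharTwo.add_self_eq_zero] at h2
  simp only [only11, Set.mem_ofPred_eq, ← Set.not_nonempty_iff_eq_empty]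
  tauto

theorem coveredBy_typeCode_erasurePattern_iff {a b : ZMod 2} {y : Fin n → Option (ZMod 2)} :
    (coveredBy (typeCode C i j a b) (erasurePattern i j y)).Nonempty ↔
      ∃ c ∈ C, c i = a ∧ c j = b ∧ ∀ k, k ≠ i ∧ k ≠ j → y k = none ∨ c k = 0 := by
  rw [coveredBy_typeCode_nonempty_iff]
  refine exists_congr fun c => and_congr_right fun _ => and_congr_right fun _ =>
    and_congr_right fun _ => forall_congr' fun k => ?_
  rcases zmod_two_eq_zero_or_one (c k) with h | h <;> simp [h, erasurePattern]

/-- Forced erasures are bits of bias 1; this is why the isoperimetric inequality admits unequal and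
degenerate biases. -/
theorem patternLaw_eq_prodLaw (ε : ℝ) (i j : Fin n) :
    patternLaw ε i j = prodLaw fun k => if k = i ∨ k = j then 1 else ε := by
  ext z
  refine Finset.prod_congr rfl fun k _ => ?_
  by_cases hk : k = i ∨ k = j <;> simp [hk]

theorem patternLaw_eq_zero {z : Fin n → ZMod 2} (h : ¬(z i = 1 ∧ z j = 1)) :
    patternLaw ε i j z = 0 := by
  obtain ⟨k, hk, hz⟩ : ∃ k, (k = i ∨ k = j) ∧ z k ≠ 1 := by
    by_contra! hc
    exact h ⟨hc i (Or.inl rfl), hc j (Or.inr rfl)⟩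
  exact Finset.prod_eq_zero (Finset.mem_univ k) (by rw [if_pos hk, if_neg hz])

/-- The patterns which, together with `i` and `j`, cover a codeword that does not vanish at both
`i` and `j`. -/
def coveringPatterns (C : Submodule (ZMod 2) (Fin n → ZMod 2)) (i j : Fin n) :
    Set (Fin n → ZMod 2) :=
  {z | ∃ c ∈ C, (c i = 1 ∨ c j = 1) ∧ ∀ k, k ≠ i ∧ k ≠ j → c k = 1 → z k = 1}

theorem isIncreasing_coveringPatterns : IsIncreasing (coveringPatterns C i j) := by
  rintro z ⟨c, hc, hij, hz⟩ z' hzz'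
  exact ⟨c, hc, hij, fun k hk h => hzz' k (hz k hk h)⟩

theorem mem_coveringPatterns_iff {z : Fin n → ZMod 2} (hi : z i = 1) (hj : z j = 1) :
    z ∈ coveringPatterns C i j ↔
      (coveredBy (typeCode C i j 0 1) z).Nonempty ∨
        (coveredBy (typeCode C i j 1 0) z).Nonempty ∨
        (coveredBy (typeCode C i j 1 1) z).Nonempty := by
  simp only [coveredBy_typeCode_nonempty_iff]
  constructor
  · rintro ⟨c, hc, hij, hz⟩
    have hz' : ∀ k, c k = 1 → z k = 1 := by
      intro k hk
      by_cases h1 : k = i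
      · rwa [h1]
      by_cases h2 : k = j
      · rwa [h2]
      exact hz k ⟨h1, h2⟩ hk
    rcases zmod_two_eq_zero_or_one (c i) with h1 | h1 <;>
      rcases zmod_two_eq_zero_or_one (c j) with h2 | h2
    · simp [h1, h2] at hij
    · exact Or.inl ⟨c, hc, h1, h2, hz'⟩
    · exact Or.inr (Or.inl ⟨c, hc, h1, h2, hz'⟩)
    · exact Or.inr (Or.inr ⟨c, hc, h1, h2, hz'⟩)
  · rintro (⟨c, hc, h1, h2, hz⟩ | ⟨c, hc, h1, h2, hz⟩ | ⟨c, hc, h1, h2, hz⟩)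
    · exact ⟨c, hc, Or.inr h2, fun k _ => hz k⟩
    · exact ⟨c, hc, Or.inl h1, fun k _ => hz k⟩
    · exact ⟨c, hc, Or.inl h1, fun k _ => hz k⟩

/-- A pattern at the boundary of the covering patterns covers exactly one nonzero type: otherwise
the sum of two covered codewords of distinct types would avoid the pivotal coordinate. -/
theorem mem_exactlyOne_of_boundary {z : Fin n → ZMod 2} (hi : z i = 1) (hj : z j = 1)
    (hz : z ∈ coveringPatterns C i j) {k : Fin n}
    (hk : Function.update z k 0 ∉ coveringPatterns C i j) :
    z ∈ only01 C i j ∪ only10 C i j ∪ only11 C i j := by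
  rw [mem_exactlyOne_iff]
  refine ⟨(mem_coveringPatterns_iff hi hj).1 hz, ?_⟩
  simp only [coveredBy_typeCode_nonempty_iff]
  rintro ⟨⟨c, hc, hci, hcj, hcz⟩, ⟨c', hc', hci', hcj', hcz'⟩⟩
  -- A covered word of nonzero type that avoids `k` would stay covered after `k` is deleted.
  have hone : ∀ d ∈ C, (d i = 1 ∨ d j = 1) → (∀ l, d l = 1 → z l = 1) → d k = 1 := by
    intro d hd hij hdz
    by_contra hdk
    refine hk ⟨d, hd, hij, fun l _ hdl => ?_⟩
    have hlk : l ≠ k := by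
      rintro rfl
      exact hdk hdl
    rw [Function.update_of_ne hlk]
    exact hdz l hdl
  have h1 := hone c hc (Or.inr hcj) hcz
  have h2 := hone c' hc' (Or.inl hci') hcz'
  have h3 := hone (c + c') (C.add_mem hc hc') (Or.inl (by simp [hci, hci'])) fun l hl => by
    rcases zmod_two_eq_zero_or_one (c l) with h0 | h1
    · rw [Pi.add_apply, h0, zero_add] at hl
      exact hcz' l hl
    · exact hcz l h1
  rw [Pi.add_apply, h1, h2] at h3
  exact absurd h3 (by decide)

theorem isoperimetry_coveringPatterns (h0 : 0 ≤ ε) (h1 : ε ≤ 1) :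
    1 / 2 * (prob (patternLaw ε i j) (coveringPatterns C i j) *
        (1 - prob (patternLaw ε i j) (coveringPatterns C i j))) ≤
      √n * prob (patternLaw ε i j) (only01 C i j ∪ only10 C i j ∪ only11 C i j) := by
  have hp0 : ∀ k : Fin n, 0 ≤ if k = i ∨ k = j then 1 else ε := fun k => by
    split_ifs <;> linarith
  have hp1 : ∀ k : Fin n, (if k = i ∨ k = j then 1 else ε) ≤ 1 := fun k => by
    split_ifs <;> linarith
  have hpos : ∀ z, 0 ≤ patternLaw ε i j z := by
    rw [patternLaw_eq_prodLaw]
    exact prodLaw_nonneg hp0 hp1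
  have hb := le_sqrt_mul_prob_boundary hp0 hp1
    (isIncreasing_coveringPatterns (C := C) (i := i) (j := j))
  rw [← patternLaw_eq_prodLaw] at hb
  refine hb.trans (mul_le_mul_of_nonneg_left ?_ (Real.sqrt_nonneg _))
  set U := only01 C i j ∪ only10 C i j ∪ only11 C i j
  have hsub : {z | z ∈ coveringPatterns C i j ∧
      ∃ k, z k = 1 ∧ Function.update z k 0 ∉ coveringPatterns C i j} ⊆
      U ∪ {z | ¬(z i = 1 ∧ z j = 1)} := by
    rintro z ⟨hz, k, -, hk⟩
    by_cases hij : z i = 1 ∧ z j = 1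
    · exact Or.inl (mem_exactlyOne_of_boundary hij.1 hij.2 hz hk)
    · exact Or.inr hij
  refine (prob_mono hpos hsub).trans ((prob_union_le hpos _ _).trans ?_)
  have hnull : prob (patternLaw ε i j) {z | ¬(z i = 1 ∧ z j = 1)} = 0 :=
    prob_eq_zero fun z hz => patternLaw_eq_zero (by simpa using hz)
  rw [hnull, add_zero]

/-- The first entropy is the probability that (1,0) or (1,1) is covered; knowing X_j leaves only
(1,0). The difference is the event that (1,1) is covered without (1,0). -/
theorem condMutualInfo_eq_prob_only11 :
    condMutualInfo (becLaw C ε) (bitX i) (bitX j) (outExceptTwo i j) =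
      prob (patternLaw ε i j) (only11 C i j) := by
  unfold condMutualInfo
  rw [condEntropy_bitX_outExceptTwo, condEntropy_bitX_bitX_outExceptTwo,
    ← prob_becLaw_erasurePattern (C := C), sub_eq_iff_eq_add, add_comm, ← prob_union_of_disjoint]
  · congr 1
    ext ω
    simp only [Set.mem_union, Set.mem_ofPred_eq, mem_only11_iff,
      ← coveredBy_typeCode_erasurePattern_iff]
    have : (∃ c ∈ C, c i = 1 ∧ ∀ k, k ≠ i ∧ k ≠ j → ω.2 k = none ∨ c k = 0) ↔
        (coveredBy (typeCode C i j 1 0) (erasurePattern i j ω.2)).Nonempty ∨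
          (coveredBy (typeCode C i j 1 1) (erasurePattern i j ω.2)).Nonempty := by
      simp only [coveredBy_typeCode_erasurePattern_iff]
      constructor
      · rintro ⟨c, hc, hi, hk⟩
        rcases zmod_two_eq_zero_or_one (c j) with h | h
        · exact Or.inl ⟨c, hc, hi, h, hk⟩
        · exact Or.inr ⟨c, hc, hi, h, hk⟩
      · rintro (⟨c, hc, hi, -, hk⟩ | ⟨c, hc, hi, -, hk⟩) <;> exact ⟨c, hc, hi, hk⟩
    rw [this]
    tauto
  · rw [Set.disjoint_left]
    intro ω h h'
    simp only [Set.mem_ofPred_eq, mem_only11_iff, coveredBy_typeCode_erasurePattern_iff] at h h'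
    exact h'.2 h

theorem sum_patternLaw (ε : ℝ) (i j : Fin n) : ∑ z, patternLaw ε i j z = 1 := by
  rw [patternLaw_eq_prodLaw, sum_prodLaw]

theorem condEntropy_bitX_le_prob_coveringPatterns (h0 : 0 ≤ ε) (h1 : ε ≤ 1) :
    condEntropy (becLaw C ε) (bitX i) (outExcept i) ≤
      prob (patternLaw ε i j) (coveringPatterns C i j) := by
  rw [condEntropy_bitX_outExcept, ← prob_becLaw_erasurePattern (C := C)]
  refine prob_mono (becLaw_nonneg h0 h1) ?_
  rintro ω ⟨c, hc, hi, hk⟩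
  refine ⟨c, hc, Or.inl hi, fun k hkij hck => ?_⟩
  have := hk k hkij.1
  simp_all [erasurePattern]

/-- A covering pattern outside U covers all three types. Its word of type (1,0) vanishes at `j`, so
it is invisible even when Y_j is seen. -/
theorem prob_coveringPatterns_le (h0 : 0 ≤ ε) (h1 : ε ≤ 1) :
    prob (patternLaw ε i j) (coveringPatterns C i j) ≤
      prob (patternLaw ε i j) (only01 C i j ∪ only10 C i j ∪ only11 C i j) +
        condEntropy (becLaw C ε) (bitX i) (outExcept i) := by
  rw [condEntropy_bitX_outExcept, ← prob_becLaw_erasurePattern (C := C),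
    ← prob_becLaw_erasurePattern (C := C)]
  refine (prob_mono (becLaw_nonneg h0 h1) ?_).trans (prob_union_le (becLaw_nonneg h0 h1) _ _)
  intro ω hω
  have hi : erasurePattern i j ω.2 i = 1 := by simp [erasurePattern]
  have hj : erasurePattern i j ω.2 j = 1 := by simp [erasurePattern]
  rw [Set.mem_ofPred_eq, mem_coveringPatterns_iff hi hj] at hω
  by_cases h10 : (coveredBy (typeCode C i j 1 0) (erasurePattern i j ω.2)).Nonempty
  · right
    obtain ⟨c, hc, hci, hcj, hk⟩ := coveredBy_typeCode_erasurePattern_iff.1 h10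
    refine ⟨c, hc, hci, fun k hki => ?_⟩
    by_cases hkj : k = j
    · exact Or.inr (hkj ▸ hcj)
    · exact hk k ⟨hki, hkj⟩
  · exact Or.inl (mem_exactlyOne_iff.2 ⟨hω, fun h => h10 h.2⟩)

theorem entropy_bitX (hsum : ∑ ω, becLaw C ε ω = 1) (i : Fin n) :
    entropy (becLaw C ε) (bitX i) = prob (becLaw C ε) {_ω | ∃ c ∈ C, c i = 1} := by
  -- Entropy is conditional entropy given a constant, to which every codeword is invisible.
  have h := condEntropy_bitX (C := C) (ε := ε) i (W := fun _ => ()) (by simp) (by simp)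
  simp only [and_true] at h
  rw [← h]
  simp [condEntropy, entropy, entropyGiven, condProb, prob_univ, hsum]

theorem entropy_bitX_eq_one (hsum : ∑ ω, becLaw C ε ω = 1) {c : Fin n → ZMod 2} (hc : c ∈ C)
    (hi : c i = 1) : entropy (becLaw C ε) (bitX i) = 1 := by
  rw [entropy_bitX hsum, ← hsum, ← prob_univ]
  congr 1
  exact Set.eq_univ_of_forall fun _ => ⟨c, hc, hi⟩

theorem condEntropy_mem_Ioo_of_mutualInfo_mem_Ioo (h0 : 0 ≤ ε) (h1 : ε ≤ 1)
    (hsum : ∑ ω, becLaw C ε ω = 1) {δ : ℝ} (hδ : 0 < δ)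
    (h : mutualInfo (becLaw C ε) (bitX i) (outExcept i) ∈ Set.Ioo δ (1 - δ)) :
    condEntropy (becLaw C ε) (bitX i) (outExcept i) ∈ Set.Ioo δ (1 - δ) := by
  have hpos : 0 ≤ condEntropy (becLaw C ε) (bitX i) (outExcept i) := by
    rw [condEntropy_bitX_outExcept]
    exact prob_nonneg (becLaw_nonneg h0 h1) _
  unfold mutualInfo at h
  by_cases hc : ∃ c ∈ C, c i = 1
  · obtain ⟨c, hc, hi⟩ := hc
    rw [entropy_bitX_eq_one hsum hc hi] at h
    exact ⟨by linarith [h.2], by linarith [h.1]⟩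
  -- A constant code bit has zero entropy, too little for information above `δ`.
  · have hnull : prob (becLaw C ε) {_ω | ∃ c ∈ C, c i = 1} = 0 :=
      prob_eq_zero fun ω hω => absurd hω hc
    rw [entropy_bitX hsum, hnull] at h
    linarith [h.1]

theorem div_sqrt_le_prob_exactlyOne (h0 : 0 ≤ ε) (h1 : ε ≤ 1) {δ : ℝ} (hδ : 0 < δ)
    (h : condEntropy (becLaw C ε) (bitX i) (outExcept i) ∈ Set.Ioo δ (1 - δ)) :
    δ / 8 / √n ≤ prob (patternLaw ε i j) (only01 C i j ∪ only10 C i j ∪ only11 C i j) := by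
  have hn : (1 : ℝ) ≤ √n := by
    rw [Real.one_le_sqrt]
    exact_mod_cast i.pos
  have hiso := isoperimetry_coveringPatterns (C := C) (i := i) (j := j) h0 h1
  have hlo := condEntropy_bitX_le_prob_coveringPatterns (C := C) (i := i) (j := j) h0 h1
  have hhi := prob_coveringPatterns_le (C := C) (i := i) (j := j) h0 h1
  set r := prob (patternLaw ε i j) (only01 C i j ∪ only10 C i j ∪ only11 C i j)
  set a := prob (patternLaw ε i j) (coveringPatterns C i j)
  rw [div_le_iff₀ (by linarith)]
  obtain ⟨hl, hr⟩ := h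
  by_cases hr2 : δ / 2 ≤ r
  · nlinarith
  · have ha0 : δ ≤ a := by linarith
    have ha1 : δ / 2 ≤ 1 - a := by linarith
    -- One of a, 1-a is at least 1/2 and the other at least δ/2, so a(1-a)/2 ≥ δ/8.
    rcases le_total a (1 / 2) with ha | ha <;> nlinarith

end Patterns

theorem theorem4 :
    ∃ c : ℝ → ℝ,
      (∀ δ₀ : ℝ, 0 < δ₀ → ∃ κ : ℝ, 0 < κ ∧ ∀ δ : ℝ, δ₀ ≤ δ → δ < 1 / 2 → κ ≤ c δ) ∧
      ∀ (δ : ℝ), 0 < δ → δ < 1 / 2 →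
      ∀ (n : ℕ) (C : Submodule (ZMod 2) (Fin n → ZMod 2)) (ε : ℝ), 0 ≤ ε → ε ≤ 1 →
      ∀ (i j : Fin n), i ≠ j →
        mutualInfo (becLaw C ε) (bitX i) (outExcept i) ∈ Set.Ioo δ (1 - δ) →
          0 < prob (patternLaw ε i j) (only01 C i j ∪ only10 C i j ∪ only11 C i j) ∧
          c δ / Real.sqrt n * alphaCoeff C ε i j ≤
            condMutualInfo (becLaw C ε) (bitX i) (bitX j) (outExceptTwo i j) := by
  refine ⟨fun δ => δ / 8, fun δ₀ h => ⟨δ₀ / 8, by positivity, fun δ hδ _ => by linarith⟩, ?_⟩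
  intro δ hδ _ n C ε h0 h1 i j _ h
  have hsum : ∑ ω, becLaw C ε ω = 1 := (sum_becLaw C ε i j).trans (sum_patternLaw ε i j)
  have hU := div_sqrt_le_prob_exactlyOne (j := j) h0 h1 hδ
    (condEntropy_mem_Ioo_of_mutualInfo_mem_Ioo h0 h1 hsum hδ h)
  have hn : (0 : ℝ) < n := by exact_mod_cast i.pos
  have hpos : 0 < prob (patternLaw ε i j) (only01 C i j ∪ only10 C i j ∪ only11 C i j) :=
    lt_of_lt_of_le (by positivity) hU
  have h11 : 0 ≤ prob (patternLaw ε i j) (only11 C i j) := by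
    rw [← prob_becLaw_erasurePattern (C := C)]
    exact prob_nonneg (becLaw_nonneg h0 h1) _
  refine ⟨hpos, ?_⟩
  -- Both sides carry the factor P(B₄), so the lower bound on P(U) is all that is needed.
  rw [condMutualInfo_eq_prob_only11, alphaCoeff, condProb,
    Set.inter_eq_left.2 Set.subset_union_right, mul_div_assoc', div_le_iff₀ hpos, mul_comm]
  exact mul_le_mul_of_nonneg_left hU h11
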